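/- There are an absolute constant $K$ and a deterministic algorithm with the following property. Let $E$ be a ground set with $n\ge 1$ elements, let $f:2^E\to\mathbb{R}_{\ge 0}$ be a non-negative set function that is monotone ($f(A)\le f(B)$ for $A\subseteq B$) and submodular ($f(A)+f(B)\ge f(A\cap B)+f(A\cup B)$ for all $A,B\subseteq E$), let $p\ge 1$ be real and let $\mathcal{I}\subseteq 2^E$ be a $p$-system, that is, $\emptyset\in\mathcal{I}$, every subset of a member of $\mathcal{I}$ is in $\mathcal{I}$, and for every $A\subseteq E$ any two inclusion-maximal sets $B_1,B_2$ among the members of $\mathcal{I}$ contained in $A$ satisfy $|B_1|\le p\,|B_2|$. Let $d\ge 0$ be an integer, let $c_1,\dots,c_d:E\to\mathbb{R}_{\ge 0}$ be cost functions, and let $0<\varepsilon<1$. Call $S\subseteq E$ feasible if $S\in\mathcal{I}$ and $\sum_{e\in S}c_i(e)\le 1$ for $i=1,\dots,d$. The algorithm is given $E$, $d$, $p$, $\varepsilon$ and the costs $c_i(e)$ explicitly, and has access to $f$ and $\mathcal{I}$ only through a value oracle (which returns $f(S)$ for a queried set $S\subseteq E$) and an independence oracle (which tells whether $S\in\mathcal{I}$).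 It outputs a feasible set $S^*$ with $$f(S^*)\;\ge\;\Big(\frac{1}{p+\frac{7}{4}d+1}-\varepsilon\Big)\max\{f(T): T\subseteq E \text{ feasible}\},$$ and the total number of queries that it makes to the two oracles is at most $$K\cdot\frac{n}{\varepsilon}\log\frac{n}{\varepsilon}\cdot\max\Big\{\log\frac{1}{\varepsilon},\ \log\log n\Big\},$$ where for $n=1$ the maximum is read as $\log\frac1\varepsilon$. Algorithms are understood in the oracle model: deterministic adaptive procedures whose cost is the number of oracle queries. -/

import Mathlib

/-- A set function `f : 2^E → ℝ` is submodular if `f (A ∩ B) + f (A ∪ B) ≤ f A + f B` for all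
`A, B ⊆ E`. -/
def SubmodularFn {E : Type*} [DecidableEq E] (f : Finset E → ℝ) : Prop :=
  ∀ A B : Finset E, f (A ∩ B) + f (A ∪ B) ≤ f A + f B

/-- `B` is a base of `A` with respect to the family `I`: an inclusion-maximal member of `I` among
the subsets of `A`. -/
def IsBaseOf {E : Type*} (I : Finset (Finset E)) (A B : Finset E) : Prop :=
  Maximal (fun S : Finset E => S ∈ I ∧ S ⊆ A) B

/-- `I` is a `p`-system on `E`: a non-empty, down-closed family of (independent) sets such that for
every `A ⊆ E` the cardinalities of any two bases of `A` differ by a factor of at most `p`. -/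
structure IsPSystem {E : Type*} (p : ℝ) (I : Finset (Finset E)) : Prop where
  empty_mem : ∅ ∈ I
  down_closed : ∀ S ∈ I, ∀ T : Finset E, T ⊆ S → T ∈ I
  base_ratio : ∀ A B₁ B₂ : Finset E, IsBaseOf I A B₁ → IsBaseOf I A B₂ →
    (B₁.card : ℝ) ≤ p * (B₂.card : ℝ)

/-- `S` satisfies the independence constraint `S ∈ I` and the `d` knapsack constraints
`∑ e ∈ S, c i e ≤ 1`. -/
def IsFeasible {E : Type*} {d : ℕ} (I : Finset (Finset E)) (c : Fin d → E → ℝ)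
    (S : Finset E) : Prop :=
  S ∈ I ∧ ∀ i : Fin d, ∑ e ∈ S, c i e ≤ 1

/-- A deterministic adaptive algorithm in the oracle model. It either stops and outputs a set, or
makes one query, to the value oracle (answered by `f S`) or to the independence oracle (answered by
whether `S ∈ I`), and continues in a way that depends on the answer. -/
inductive OracleAlg (E : Type) : Type where
  | output (S : Finset E) : OracleAlg E
  | askValue (S : Finset E) (next : ℝ → OracleAlg E) : OracleAlg E
  | askIndep (S : Finset E) (next : Bool → OracleAlg E) : OracleAlg E

/-- The set that the algorithm outputs when the oracles are those of `f` and `I`. -/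
def OracleAlg.result {E : Type} [DecidableEq E] (f : Finset E → ℝ) (I : Finset (Finset E)) :
    OracleAlg E → Finset E
  | .output S => S
  | .askValue S next => (next (f S)).result f I
  | .askIndep S next => (next (decide (S ∈ I))).result f I

/-- The total number of value and independence queries that the algorithm makes when the oracles
are those of `f` and `I`. -/
def OracleAlg.queries {E : Type} [DecidableEq E] (f : Finset E → ℝ) (I : Finset (Finset E)) :
    OracleAlg E → ℕ
  | .output _ => 0
  | .askValue S next => (next (f S)).queries f I + 1
  | .askIndep S next => (next (decide (S ∈ I))).queries f I + 1

/-! Fix a density `ρ`. Starting from the empty set, pass over the elements with thresholds falling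
geometrically from `M`, the best value among the empty set and the feasible singletons, and add each
light element that keeps independence and whose marginal value is at least the threshold and at
least `ρ` times its total cost. There are two outcomes.

If a knapsack overflows, some subset of the current set fits and has total cost at least `2 / 3`
(`exists_fits_two_thirds`). Every subset has density at least `ρ`, so this one has value at least `2
/ 3 * ρ` (`scan_overflow`).

If nothing overflows, the final set `S` is compared with a feasible `O` through the marginals of the
elements of `O` (`le_of_sweep_completed`). Dense light elements outside `S` were rejected only for
dependence or for falling below the last threshold, and the `p`-system property charges them to `S`
at a cost of about `p * f S` (`sum_rejected_le`). Light elements of low density contribute at most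
`ρ` times their cost. Each of the `h ≤ d` heavy elements contributes at most `M`, but uses up cost
`1 / 2`. If `v` bounds `M` and `f S` and `ρ ≈ 3 / 2 * v`, the last two groups give `(3 / 2 * (d - h
/ 2) + h) * v ≤ 7 / 4 * d * v`.

It remains to find a `ρ` close to `3 / 2` of the best value found. Bisection on a geometric grid
locates two adjacent densities, of which the lower is certified by a value already found and the
upper either completes or is too large to matter (`bisect_spec`). The grid has about `log n / ε`
points, so about `max (log (1 / ε)) (log (log n))` sweeps suffice, each of about `log (n / ε) / ε`
passes. -/

open Finset

/-! ### Submodular functions -/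

/-- The marginal value of `e` with respect to `S`. -/
def marginal {E : Type} [DecidableEq E] (f : Finset E → ℝ) (S : Finset E) (e : E) : ℝ :=
  f (insert e S) - f S

theorem marginal_nonneg {E : Type} [DecidableEq E] {f : Finset E → ℝ} (hf : Monotone f)
    (S : Finset E) (e : E) : 0 ≤ marginal f S e :=
  sub_nonneg.2 (hf (subset_insert e S))

theorem marginal_anti {E : Type} [DecidableEq E] {f : Finset E → ℝ} (hf : Monotone f)
    (hs : SubmodularFn f) {S T : Finset E} (h : S ⊆ T) (e : E) :
    marginal f T e ≤ marginal f S e := by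
  by_cases he : e ∈ T
  · have : marginal f T e = 0 := by simp [marginal, insert_eq_of_mem he]
    rw [this]
    exact marginal_nonneg hf S e
  · have h1 : insert e S ∩ T = S := by
      rw [insert_inter_of_notMem he, inter_eq_left.2 h]
    have h2 : insert e S ∪ T = insert e T := by
      rw [insert_union, union_eq_right.2 h]
    have := hs (insert e S) T
    rw [h1, h2] at this
    unfold marginal
    linarith

theorem union_le_add_sum_marginal {E : Type} [DecidableEq E] {f : Finset E → ℝ} (hf : Monotone f)
    (hs : SubmodularFn f) (S O : Finset E) : f (S ∪ O) ≤ f S + ∑ o ∈ O, marginal f S o := by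
  induction O using Finset.induction_on with
  | empty => simp
  | insert a O ha ih =>
    rw [sum_insert ha, union_insert]
    have : marginal f (S ∪ O) a ≤ marginal f S a := marginal_anti hf hs subset_union_left a
    unfold marginal at this ih ⊢
    linarith

theorem marginal_le_singleton {E : Type} [DecidableEq E] {f : Finset E → ℝ} (hf : Monotone f)
    (hs : SubmodularFn f) (h0 : ∀ S, 0 ≤ f S) (S : Finset E) (e : E) :
    marginal f S e ≤ f {e} := by
  have h1 := marginal_anti hf hs (empty_subset S) e
  have h2 : marginal f ∅ e = f {e} - f ∅ := by simp [marginal]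
  linarith [h0 ∅]

/-! ### Independence systems -/

/-- Since `S` blocks all of `H`, it is a base of `S ∪ H`; `H` extends to another base of the same
set, and the ratio of bases applies. -/
theorem IsPSystem.card_le_of_blocked {E : Type} [DecidableEq E] {p : ℝ} {I : Finset (Finset E)}
    (hI : IsPSystem p I) {S H : Finset E} (hS : S ∈ I) (hH : H ∈ I)
    (hb : ∀ o ∈ H, insert o S ∉ I) : (H.card : ℝ) ≤ p * S.card := by
  have hbase : IsBaseOf I (S ∪ H) S := by
    refine ⟨⟨hS, subset_union_left⟩, fun B hB hSB x hx => ?_⟩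
    by_contra hxS
    have hxH : x ∈ H := (mem_union.1 (hB.2 hx)).resolve_left hxS
    exact hb x hxH (hI.down_closed B hB.1 _ (insert_subset hx hSB))
  obtain ⟨B, hHB, hB⟩ : ∃ B, H ⊆ B ∧ IsBaseOf I (S ∪ H) B := by
    have hfin : {T : Finset E | T ∈ I ∧ T ⊆ S ∪ H}.Finite :=
      I.finite_toSet.subset fun T hT => hT.1
    obtain ⟨B, h1, h2⟩ := hfin.exists_le_maximal (a := H) ⟨hH, subset_union_right⟩
    exact ⟨B, h1, h2⟩
  calc (H.card : ℝ) ≤ B.card := by exact_mod_cast card_le_card hHB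
    _ ≤ p * S.card := hI.base_ratio _ _ _ hB hbase

/-! ### Knapsack constraints -/

/-- The set `S` satisfies all knapsack constraints. -/
def Fits {E : Type} {d : ℕ} (c : Fin d → E → ℝ) (S : Finset E) : Prop :=
  ∀ i : Fin d, ∑ e ∈ S, c i e ≤ 1

/-- No cost of `e` exceeds half of the budget. -/
def Light {E : Type} {d : ℕ} (c : Fin d → E → ℝ) (e : E) : Prop :=
  ∀ i : Fin d, c i e ≤ 1 / 2

/-- The sum of the costs of `e` over all knapsacks. -/
def totalCost {E : Type} {d : ℕ} (c : Fin d → E → ℝ) (e : E) : ℝ :=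
  ∑ i, c i e

theorem totalCost_nonneg {E : Type} {d : ℕ} {c : Fin d → E → ℝ} (hc : ∀ i e, 0 ≤ c i e) (e : E) :
    0 ≤ totalCost c e :=
  sum_nonneg fun i _ => hc i e

theorem sum_cost_le_sum_totalCost {E : Type} {d : ℕ} {c : Fin d → E → ℝ}
    (hc : ∀ i e, 0 ≤ c i e) (i : Fin d) (S : Finset E) :
    ∑ e ∈ S, c i e ≤ ∑ e ∈ S, totalCost c e :=
  sum_le_sum fun e _ => single_le_sum (f := fun i => c i e) (fun j _ => hc j e) (mem_univ i)

theorem Fits.of_sum_totalCost_le {E : Type} {d : ℕ} {c : Fin d → E → ℝ}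
    (hc : ∀ i e, 0 ≤ c i e) {S : Finset E} (h : ∑ e ∈ S, totalCost c e ≤ 1) : Fits c S :=
  fun i => (sum_cost_le_sum_totalCost hc i S).trans h

theorem Fits.sum_totalCost_le {E : Type} {d : ℕ} {c : Fin d → E → ℝ} {S : Finset E}
    (h : Fits c S) : ∑ e ∈ S, totalCost c e ≤ d := by
  unfold totalCost
  rw [sum_comm]
  calc ∑ i, ∑ e ∈ S, c i e ≤ ∑ _i : Fin d, (1 : ℝ) := sum_le_sum fun i _ => h i
    _ = d := by simp

theorem Fits.mono {E : Type} {d : ℕ} {c : Fin d → E → ℝ} (hc : ∀ i e, 0 ≤ c i e)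
    {S T : Finset E} (hT : Fits c T) (h : S ⊆ T) : Fits c S :=
  fun i => (sum_le_sum_of_subset_of_nonneg h fun e _ _ => hc i e).trans (hT i)

/-- Elements of a fitting set that are not light: at most one for each knapsack. -/
theorem Fits.card_heavy_le {E : Type} {d : ℕ} {c : Fin d → E → ℝ}
    (hc : ∀ i e, 0 ≤ c i e) {H : Finset E} (h : Fits c H) (hH : ∀ e ∈ H, ¬ Light c e) :
    H.card ≤ d := by
  classical
  have hex : ∀ e ∈ H, ∃ i : Fin d, 1 / 2 < c i e := fun e he => by
    simpa [Light] using hH e he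
  choose g hg using hex
  -- Two elements exceeding `1 / 2` in the same knapsack would overflow it.
  have hinj : Set.InjOn (fun e : H => g e.1 e.2) Set.univ := by
    rintro ⟨a, ha⟩ - ⟨b, hb⟩ - hab
    by_contra hne
    have hne' : a ≠ b := fun h' => hne (Subtype.ext h')
    have h1 := h (g a ha)
    have h2 : ∑ e ∈ {a, b}, c (g a ha) e ≤ ∑ e ∈ H, c (g a ha) e :=
      sum_le_sum_of_subset_of_nonneg (by simp [insert_subset_iff, ha, hb]) fun e _ _ => hc _ e
    rw [sum_pair hne'] at h2
    have h3 := hg a ha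
    have h4 := hg b hb
    simp only at hab
    rw [← hab] at h4
    linarith
  have := Fintype.card_le_of_injective _ (Set.injOn_univ.1 hinj)
  simpa using this

theorem half_le_totalCost_of_not_light {E : Type} {d : ℕ} {c : Fin d → E → ℝ}
    (hc : ∀ i e, 0 ≤ c i e) {e : E} (he : ¬ Light c e) : 1 / 2 ≤ totalCost c e := by
  obtain ⟨i, hi⟩ : ∃ i : Fin d, 1 / 2 < c i e := by simpa [Light] using he
  exact hi.le.trans (single_le_sum (f := fun i => c i e) (fun j _ => hc j e) (mem_univ i))

/-- If light elements overflow some knapsack, then a subset of them fits and has total cost at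
least `2 / 3`. -/
theorem exists_fits_two_thirds {E : Type} [DecidableEq E] {d : ℕ} {c : Fin d → E → ℝ}
    (hc : ∀ i e, 0 ≤ c i e) {S : Finset E} {j : E} (hS : Fits c S)
    (hl : ∀ e ∈ insert j S, Light c e) (hj : ¬ Fits c (insert j S)) :
    ∃ T ⊆ insert j S, Fits c T ∧ 2 / 3 ≤ ∑ e ∈ T, totalCost c e := by
  by_cases hbig : 2 / 3 ≤ ∑ e ∈ S, totalCost c e
  · exact ⟨S, subset_insert _ _, hS, hbig⟩
  push Not at hbig
  have hjS : j ∉ S := fun h => hj (by rwa [insert_eq_of_mem h])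
  obtain ⟨i, hi⟩ : ∃ i, 1 < ∑ e ∈ insert j S, c i e := by simpa [Fits] using hj
  have htot : 1 < ∑ e ∈ insert j S, totalCost c e :=
    hi.trans_le (sum_cost_le_sum_totalCost hc i _)
  have hcj : 1 / 3 < totalCost c j := by
    rw [sum_insert hjS] at htot
    linarith
  -- Such an `e` together with `j` is enough: two light elements always fit, and each has total cost
  -- at least `1 / 3`.
  by_cases hex : ∃ e ∈ S, 1 / 3 ≤ totalCost c e
  · obtain ⟨e, he, hce⟩ := hex
    have hne : e ≠ j := fun h => hjS (h ▸ he)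
    refine ⟨{e, j}, by simp [insert_subset_iff, he], fun k => ?_, ?_⟩
    · rw [sum_pair hne]
      linarith [hl e (mem_insert_of_mem he) k, hl j (mem_insert_self _ _) k]
    · rw [sum_pair hne]
      linarith
  push Not at hex
  -- All elements of `S` now cost less than `1 / 3`. Grow `{j}` one element at a time: when the
  -- total first reaches `2 / 3` it is still below `1`, so no single knapsack overflows. If `{j}`
  -- alone suffices, it fits because `j` is light.
  have key : ∀ U : Finset E, U ⊆ S → 2 / 3 ≤ ∑ e ∈ insert j U, totalCost c e →
      ∃ T ⊆ insert j U, Fits c T ∧ 2 / 3 ≤ ∑ e ∈ T, totalCost c e := by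
    intro U
    induction U using Finset.induction_on with
    | empty =>
      intro _ h
      refine ⟨_, Subset.rfl, fun k => ?_, h⟩
      have := hl j (mem_insert_self _ _) k
      simp only [insert_empty_eq, sum_singleton]
      linarith
    | insert a U ha ih =>
      intro hU h
      have haS := hU (mem_insert_self a U)
      have hjU : j ∉ U := fun h' => hjS (hU (mem_insert_of_mem h'))
      have haj : a ∉ insert j U := by
        rw [mem_insert, not_or]
        exact ⟨fun h' => hjS (h' ▸ haS), ha⟩
      rw [insert_comm] at h ⊢
      by_cases hlow : 2 / 3 ≤ ∑ e ∈ insert j U, totalCost c e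
      · obtain ⟨T, h1, h2⟩ := ih ((subset_insert _ _).trans hU) hlow
        exact ⟨T, h1.trans (subset_insert _ _), h2⟩
      · refine ⟨_, Subset.rfl, Fits.of_sum_totalCost_le hc ?_, h⟩
        rw [sum_insert haj]
        linarith [hex a haS]
  exact key S Subset.rfl (by linarith)

open Classical in
/-- A subset of `A` that satisfies the knapsack constraints and has total cost at least `2 / 3`,
if there is one. -/
noncomputable def trim {E : Type} {d : ℕ} (c : Fin d → E → ℝ) (A : Finset E) : Finset E :=
  if h : ∃ T ⊆ A, Fits c T ∧ 2 / 3 ≤ ∑ e ∈ T, totalCost c e then h.choose else ∅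

theorem trim_spec {E : Type} {d : ℕ} {c : Fin d → E → ℝ} {A : Finset E}
    (h : ∃ T ⊆ A, Fits c T ∧ 2 / 3 ≤ ∑ e ∈ T, totalCost c e) :
    trim c A ⊆ A ∧ Fits c (trim c A) ∧ 2 / 3 ≤ ∑ e ∈ trim c A, totalCost c e := by
  rw [trim, dif_pos h]
  exact h.choose_spec

/-! ### One pass over the elements -/

open Classical in
/-- One pass over a list of elements, which adds to `S` every light element that keeps it
independent and has marginal value at least `τ` and marginal density at least `ρ`. The pass stops at
the first overflow of a knapsack; the first component tells whether this happened. -/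
noncomputable def scan {E : Type} [DecidableEq E] {d : ℕ} (f : Finset E → ℝ)
    (I : Finset (Finset E)) (c : Fin d → E → ℝ) (ρ τ : ℝ) :
    List E → Finset E → Bool × Finset E
  | [], S => (false, S)
  | e :: l, S =>
    if Light c e ∧ τ ≤ f (insert e S) - f S ∧ ρ * totalCost c e ≤ f (insert e S) - f S ∧
        decide (insert e S ∈ I) = true then
      if Fits c (insert e S) then scan f I c ρ τ l (insert e S) else (true, trim c (insert e S))
    else scan f I c ρ τ l S

/-- An independent set of light elements that satisfies the knapsack constraints and all of whose
subsets have density at least `ρ`. -/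
structure IsDense {E : Type} {d : ℕ} (f : Finset E → ℝ) (I : Finset (Finset E))
    (c : Fin d → E → ℝ) (ρ : ℝ) (S : Finset E) : Prop where
  mem : S ∈ I
  fits : Fits c S
  light : ∀ e ∈ S, Light c e
  dense : ∀ T ⊆ S, ρ * ∑ e ∈ T, totalCost c e ≤ f T

/-- By submodularity `e` adds at least as much to `T.erase e` as to `S`. Density is kept for all
subsets because trimming may return any of them. -/
theorem dense_insert {E : Type} [DecidableEq E] {d : ℕ} {f : Finset E → ℝ}
    {c : Fin d → E → ℝ} {ρ : ℝ} {S : Finset E} {e : E} (hf : Monotone f) (hs : SubmodularFn f)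
    (hS : ∀ T ⊆ S, ρ * ∑ e ∈ T, totalCost c e ≤ f T)
    (he : ρ * totalCost c e ≤ f (insert e S) - f S) :
    ∀ T ⊆ insert e S, ρ * ∑ e ∈ T, totalCost c e ≤ f T := by
  intro T hT
  by_cases heT : e ∈ T
  · have h1 : T.erase e ⊆ S := by
      rw [← subset_insert_iff]; exact hT
    have h2 := hS _ h1
    have h3 := marginal_anti hf hs h1 e
    unfold marginal at h3
    rw [insert_erase heT] at h3
    rw [← add_sum_erase T _ heT, mul_add]
    linarith
  · exact hS T ((subset_insert_iff_of_notMem heT).1 hT)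

theorem scan_overflow {E : Type} [DecidableEq E] {d : ℕ} {f : Finset E → ℝ}
    {I : Finset (Finset E)} {c : Fin d → E → ℝ} {p ρ τ : ℝ} (hc : ∀ i e, 0 ≤ c i e)
    (hf : Monotone f) (hs : SubmodularFn f) (hI : IsPSystem p I) (hρ : 0 ≤ ρ) (l : List E)
    (S : Finset E) (hS : IsDense f I c ρ S) (h : (scan f I c ρ τ l S).1 = true) :
    IsFeasible I c (scan f I c ρ τ l S).2 ∧ 2 / 3 * ρ ≤ f (scan f I c ρ τ l S).2 := by
  induction l generalizing S with
  | nil => simp [scan] at h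
  | cons e l ih =>
    unfold scan at h ⊢
    split_ifs at h ⊢ with h1 h2
    · exact ih _ ⟨of_decide_eq_true h1.2.2.2, h2,
        fun x hx => (mem_insert.1 hx).elim (fun h => h ▸ h1.1) (hS.light x),
        dense_insert hf hs hS.dense h1.2.2.1⟩ h
    · have hl : ∀ x ∈ insert e S, Light c x :=
        fun x hx => (mem_insert.1 hx).elim (fun h => h ▸ h1.1) (hS.light x)
      obtain ⟨t1, t2, t3⟩ := trim_spec (exists_fits_two_thirds hc hS.fits hl h2)
      refine ⟨⟨hI.down_closed _ (of_decide_eq_true h1.2.2.2) _ t1, t2⟩, ?_⟩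
      have := dense_insert hf hs hS.dense h1.2.2.1 _ t1
      have := mul_le_mul_of_nonneg_left t3 hρ
      simp only
      linarith
    · exact ih _ hS h

theorem scan_completed {E : Type} [DecidableEq E] {d : ℕ} {f : Finset E → ℝ}
    {I : Finset (Finset E)} {c : Fin d → E → ℝ} {p ρ τ : ℝ}
    (hf : Monotone f) (hs : SubmodularFn f) (hI : IsPSystem p I) (l : List E)
    (S : Finset E) (hS : IsDense f I c ρ S) (h : (scan f I c ρ τ l S).1 = false) :
    S ⊆ (scan f I c ρ τ l S).2 ∧ IsDense f I c ρ (scan f I c ρ τ l S).2 ∧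
      τ * (((scan f I c ρ τ l S).2.card : ℝ) - S.card) ≤ f (scan f I c ρ τ l S).2 - f S ∧
      ∀ e ∈ l, Light c e → e ∉ (scan f I c ρ τ l S).2 →
        τ ≤ marginal f (scan f I c ρ τ l S).2 e →
        ρ * totalCost c e ≤ marginal f (scan f I c ρ τ l S).2 e →
        insert e (scan f I c ρ τ l S).2 ∉ I := by
  induction l generalizing S with
  | nil => simpa [scan] using hS
  | cons e l ih =>
    unfold scan at h ⊢
    split_ifs at h ⊢ with h1 h2
    · obtain ⟨a1, a2, a3, a4⟩ := ih _ ⟨of_decide_eq_true h1.2.2.2, h2,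
        fun x hx => (mem_insert.1 hx).elim (fun h => h ▸ h1.1) (hS.light x),
        dense_insert hf hs hS.dense h1.2.2.1⟩ h
      refine ⟨(subset_insert _ _).trans a1, a2, ?_, ?_⟩
      · by_cases heS : e ∈ S
        · rwa [insert_eq_of_mem heS] at a3 ⊢
        · rw [card_insert_of_notMem heS] at a3
          push_cast at a3
          linarith [h1.2.1]
      · intro x hx
        rcases List.mem_cons.1 hx with rfl | hx
        · exact fun _ hxS => absurd (a1 (mem_insert_self _ _)) hxS
        · exact a4 x hx
    · obtain ⟨a1, a2, a3, a4⟩ := ih _ hS h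
      refine ⟨a1, a2, a3, fun x hx => ?_⟩
      rcases List.mem_cons.1 hx with rfl | hx
      · intro b1 _ b3 b4 b5
        have hm := marginal_anti hf hs a1 x
        refine h1 ⟨b1, b3.trans hm, b4.trans hm, decide_eq_true ?_⟩
        exact hI.down_closed _ b5 _ (insert_subset_insert x a1)
      · exact a4 x hx

/-! ### Decreasing thresholds -/

/-- Passes with the thresholds `τ, τ / (1 + ε), τ / (1 + ε) ^ 2, …`. -/
noncomputable def sweep {E : Type} [DecidableEq E] {d : ℕ} (f : Finset E → ℝ)
    (I : Finset (Finset E)) (c : Fin d → E → ℝ) (ρ ε : ℝ) (l : List E) :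
    ℕ → ℝ → Finset E → Bool × Finset E
  | 0, _, S => (false, S)
  | r + 1, τ, S =>
    if (scan f I c ρ τ l S).1 = true then scan f I c ρ τ l S
    else sweep f I c ρ ε l r (τ / (1 + ε)) (scan f I c ρ τ l S).2

theorem sweep_overflow {E : Type} [DecidableEq E] {d : ℕ} {f : Finset E → ℝ}
    {I : Finset (Finset E)} {c : Fin d → E → ℝ} {p ρ ε : ℝ} (hc : ∀ i e, 0 ≤ c i e)
    (hf : Monotone f) (hs : SubmodularFn f) (hI : IsPSystem p I) (hρ : 0 ≤ ρ) (l : List E)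
    (r : ℕ) (τ : ℝ) (S : Finset E) (hS : IsDense f I c ρ S)
    (h : (sweep f I c ρ ε l r τ S).1 = true) :
    IsFeasible I c (sweep f I c ρ ε l r τ S).2 ∧ 2 / 3 * ρ ≤ f (sweep f I c ρ ε l r τ S).2 := by
  induction r generalizing S τ with
  | zero => simp [sweep] at h
  | succ r ih =>
    unfold sweep at h ⊢
    split_ifs at h ⊢ with h1
    · exact scan_overflow hc hf hs hI hρ l S hS h
    · exact ih _ _ (scan_completed hf hs hI l S hS (by simpa using h1)).2.1 h

theorem sweep_completed {E : Type} [DecidableEq E] {d : ℕ} {f : Finset E → ℝ}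
    {I : Finset (Finset E)} {c : Fin d → E → ℝ} {p ρ ε : ℝ}
    (hf : Monotone f) (hs : SubmodularFn f) (hI : IsPSystem p I) (l : List E)
    (r : ℕ) (τ : ℝ) (S : Finset E) (hS : IsDense f I c ρ S)
    (h : (sweep f I c ρ ε l r τ S).1 = false) :
    S ⊆ (sweep f I c ρ ε l r τ S).2 ∧ IsDense f I c ρ (sweep f I c ρ ε l r τ S).2 := by
  induction r generalizing S τ with
  | zero => exact ⟨Subset.rfl, hS⟩
  | succ r ih =>
    unfold sweep at h ⊢
    split_ifs at h ⊢ with h1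
    · exact absurd h (by simp [h1])
    · obtain ⟨a1, a2, -⟩ := scan_completed hf hs hI l S hS (by simpa using h1)
      obtain ⟨b1, b2⟩ := ih _ _ a2 h
      exact ⟨a1.trans b1, b2⟩

/-- The elements of an independent set that are rejected for dependence can be charged to the
elements that have been selected. -/
theorem sum_rejected_le {E : Type} [DecidableEq E] {d : ℕ} {f : Finset E → ℝ}
    {I : Finset (Finset E)} {c : Fin d → E → ℝ} {p ρ ε : ℝ}
    (hf : Monotone f) (hs : SubmodularFn f) (hI : IsPSystem p I) (hp : 0 ≤ p) (hε : 0 < ε)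
    (l : List E) (hl : ∀ e, e ∈ l) (O : Finset E) (hO : O ∈ I) (hlight : ∀ o ∈ O, Light c o)
    (r : ℕ) (τ : ℝ) (hτ : 0 ≤ τ) (S : Finset E) (hS : IsDense f I c ρ S)
    (h : (sweep f I c ρ ε l r τ S).1 = false)
    (hnot : ∀ o ∈ O, o ∉ (sweep f I c ρ ε l r τ S).2)
    (hdense : ∀ o ∈ O, ρ * totalCost c o ≤ marginal f (sweep f I c ρ ε l r τ S).2 o)
    (g : E → ℝ) (hg : ∀ o ∈ O, g o ≤ marginal f (sweep f I c ρ ε l r τ S).2 o)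
    (hgτ : ∀ o ∈ O, g o ≤ (1 + ε) * τ) :
    ∑ o ∈ O, g o ≤ (1 + ε) * p * (τ * S.card + (f (sweep f I c ρ ε l r τ S).2 - f S)) +
      O.card * ((1 + ε) * τ / (1 + ε) ^ r) := by
  induction r generalizing S τ g with
  | zero =>
    -- With no passes left, everything goes into the remainder term.
    have h1 : ∑ o ∈ O, g o ≤ ∑ _o ∈ O, (1 + ε) * τ := sum_le_sum hgτ
    rw [sum_const, nsmul_eq_mul] at h1
    have h2 : 0 ≤ (1 + ε) * p * (τ * S.card) := by positivity
    simp only [sweep, sub_self, add_zero, pow_zero, div_one]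
    linarith
  | succ r ih =>
    unfold sweep at h hnot hdense hg ⊢
    split_ifs at h hnot hdense hg ⊢ with h1
    · exact absurd h (by simp [h1])
    obtain ⟨a1, a2, a3, a4⟩ := scan_completed hf hs hI l S hS (by simpa using h1)
    set S₁ := (scan f I c ρ τ l S).2
    have hsub := (sweep_completed hf hs hI l r (τ / (1 + ε)) S₁ a2 h).1
    set S' := (sweep f I c ρ ε l r (τ / (1 + ε)) S₁).2
    have hε1 : (1 + ε) ≠ 0 := by positivity
    have hτ1 : (1 + ε) * (τ / (1 + ε)) = τ := by field_simp
    -- Truncating `g` at `τ` restores the upper bound required at the next threshold. At most `p *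
    -- S₁.card` elements are truncated, each losing at most `ε * τ`; this loss raises `p * τ *
    -- S₁.card` to `(1 + ε) * p * τ * S₁.card`, and the gain of the pass pays for the elements of
    -- `S₁` beyond `S`.
    have hstep := ih (τ / (1 + ε)) (by positivity) S₁ a2 h hnot hdense (fun o => min (g o) τ)
      (fun o ho => (min_le_left _ _).trans (hg o ho)) (fun o ho => by
        rw [hτ1]; exact min_le_right _ _)
    rw [hτ1] at hstep
    have hcard : ((O.filter fun o => τ ≤ g o).card : ℝ) ≤ p * S₁.card := by
      refine hI.card_le_of_blocked a2.mem (hI.down_closed O hO _ (filter_subset _ _)) ?_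
      intro o ho
      obtain ⟨hoO, hog⟩ := mem_filter.1 ho
      have hm := marginal_anti hf hs hsub o
      exact a4 o (hl o) (hlight o hoO) (fun ho' => hnot o hoO (hsub ho'))
        (hog.trans ((hg o hoO).trans hm)) ((hdense o hoO).trans hm)
    have hsplit : ∑ o ∈ O, g o ≤
        ∑ o ∈ O, min (g o) τ + (O.filter fun o => τ ≤ g o).card * (ε * τ) := by
      rw [← nsmul_eq_mul, ← sum_const, sum_filter, ← sum_add_distrib]
      refine sum_le_sum fun o ho => ?_
      split_ifs with hle
      · rw [min_eq_right hle]
        linarith [hgτ o ho]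
      · rw [min_eq_left (not_le.1 hle).le, add_zero]
    have h5 : ((O.filter fun o => τ ≤ g o).card : ℝ) * (ε * τ) ≤ p * S₁.card * (ε * τ) :=
      mul_le_mul_of_nonneg_right hcard (by positivity)
    have h6 : (1 + ε) * p * (τ * (S₁.card - S.card)) ≤ (1 + ε) * p * (f S₁ - f S) :=
      mul_le_mul_of_nonneg_left a3 (by positivity)
    have h7 : (1 + ε) * p * (τ / (1 + ε) * S₁.card) = p * S₁.card * τ := by
      field_simp
    have h8 : (1 + ε) * τ / (1 + ε) ^ (r + 1) = τ / (1 + ε) ^ r := by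
      field_simp
      ring
    rw [h8]
    rw [mul_add, h7] at hstep
    linarith

/-- If no knapsack overflows at density `ρ`, then every feasible set is bounded in terms of any
upper bound `v` on the values found. -/
theorem le_of_sweep_completed {E : Type} [DecidableEq E] {d : ℕ} {f : Finset E → ℝ}
    {I : Finset (Finset E)} {c : Fin d → E → ℝ} {p ρ ε M v : ℝ} (hc : ∀ i e, 0 ≤ c i e)
    (hf : Monotone f) (hs : SubmodularFn f) (h0 : ∀ S, 0 ≤ f S) (hI : IsPSystem p I) (hp : 0 ≤ p)
    (hε : 0 < ε) (hρ : 0 ≤ ρ)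
    (l : List E) (hl : ∀ e, e ∈ l) (r : ℕ) (hr : (l.length : ℝ) ≤ ε * (1 + ε) ^ r)
    (hM : 0 ≤ M) (hsingle : ∀ e, IsFeasible I c {e} → f {e} ≤ M)
    (h : (sweep f I c ρ ε l (r + 1) M ∅).1 = false)
    (hMv : M ≤ v) (hv : f (sweep f I c ρ ε l (r + 1) M ∅).2 ≤ v)
    (hρv : ρ ≤ 3 / 2 * (1 + ε) * v) {O : Finset E} (hO : IsFeasible I c O) :
    f O ≤ (1 + ε) * (p + 7 / 4 * d + 1) * v := by
  classical
  have hv0 : 0 ≤ v := hM.trans hMv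
  have hempty : IsDense f I c ρ ∅ :=
    ⟨hI.empty_mem, fun i => by simp, by simp, fun T hT => by
      rw [subset_empty.1 hT]; simpa using h0 ∅⟩
  have hrej := fun O₁ a1 a2 => sum_rejected_le hf hs hI hp hε l hl O₁ a1 a2 (r + 1) M hM ∅ hempty h
  set S := (sweep f I c ρ ε l (r + 1) M ∅).2
  have hmarg : ∀ o ∈ O, marginal f S o ≤ M := fun o ho =>
    (marginal_le_singleton hf hs h0 S o).trans (hsingle o
      ⟨hI.down_closed O hO.1 _ (singleton_subset_iff.2 ho),
        Fits.mono hc hO.2 (singleton_subset_iff.2 ho)⟩)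
  have hle : f O ≤ f S + ∑ o ∈ O, marginal f S o :=
    (hf subset_union_right).trans (union_le_add_sum_marginal hf hs S O)
  set H := O.filter fun o => ¬ Light c o
  set L := O.filter fun o => Light c o
  set D := L.filter fun o => o ∉ S ∧ ρ * totalCost c o ≤ marginal f S o
  set N := L.filter fun o => ¬ (o ∉ S ∧ ρ * totalCost c o ≤ marginal f S o)
  have hsum : ∑ o ∈ O, marginal f S o =
      ∑ o ∈ D, marginal f S o + ∑ o ∈ N, marginal f S o + ∑ o ∈ H, marginal f S o := by
    rw [← sum_filter_add_sum_filter_not O (fun o => Light c o),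
      ← sum_filter_add_sum_filter_not L (fun o => o ∉ S ∧ ρ * totalCost c o ≤ marginal f S o)]
  have hDO : D ⊆ O := (filter_subset _ _).trans (filter_subset _ _)
  have hNO : N ⊆ L := filter_subset _ _
  have hHO : H ⊆ O := filter_subset _ _
  have hD : ∑ o ∈ D, marginal f S o ≤ (1 + ε) * p * v + ε * v := by
    have h1 := hrej D (hI.down_closed O hO.1 _ hDO)
      (fun o ho => (mem_filter.1 (mem_filter.1 ho).1).2) (fun o ho => (mem_filter.1 ho).2.1)
      (fun o ho => (mem_filter.1 ho).2.2) (marginal f S) (fun o _ => le_rfl)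
      (fun o ho => (hmarg o (hDO ho)).trans (le_mul_of_one_le_left hM (by linarith)))
    have h2 : (D.card : ℝ) ≤ l.length := by
      have : D ⊆ l.toFinset := fun x _ => List.mem_toFinset.2 (hl x)
      exact_mod_cast (card_le_card this).trans (List.toFinset_card_le l)
    -- The last of the `r + 1` thresholds; by `hr`, all elements together lose at most `ε * M` below
    -- it.
    have h3 : (1 + ε) * M / (1 + ε) ^ (r + 1) = M / (1 + ε) ^ r := by
      field_simp
      ring
    have h4 : (D.card : ℝ) * (M / (1 + ε) ^ r) ≤ ε * M := by
      rw [← mul_div_assoc, div_le_iff₀ (by positivity)]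
      have := mul_le_mul_of_nonneg_right (h2.trans hr) hM
      linarith
    have h5 : (1 + ε) * p * (f S - f ∅) ≤ (1 + ε) * p * v :=
      mul_le_mul_of_nonneg_left (by linarith [h0 ∅]) (by positivity)
    have h6 : ε * M ≤ ε * v := mul_le_mul_of_nonneg_left hMv hε.le
    rw [h3, card_empty, Nat.cast_zero, mul_zero, zero_add] at h1
    linarith
  have hH : ∑ o ∈ H, marginal f S o ≤ H.card * v := by
    rw [← nsmul_eq_mul, ← sum_const]
    exact sum_le_sum fun o ho => (hmarg o (hHO ho)).trans hMv
  have hHd : (H.card : ℝ) ≤ d := by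
    exact_mod_cast Fits.card_heavy_le hc (Fits.mono hc hO.2 hHO) fun e he => (mem_filter.1 he).2
  have hHcost : (H.card : ℝ) * (1 / 2) ≤ ∑ o ∈ H, totalCost c o := by
    rw [← nsmul_eq_mul, ← sum_const]
    exact sum_le_sum fun o ho => half_le_totalCost_of_not_light hc (mem_filter.1 ho).2
  have hcost : ∑ o ∈ L, totalCost c o + ∑ o ∈ H, totalCost c o ≤ d := by
    rw [sum_filter_add_sum_filter_not O (fun o => Light c o)]
    exact Fits.sum_totalCost_le hO.2
  have hN : ∑ o ∈ N, marginal f S o ≤ ρ * (d - H.card * (1 / 2)) := by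
    calc ∑ o ∈ N, marginal f S o ≤ ∑ o ∈ N, ρ * totalCost c o := by
          refine sum_le_sum fun o ho => ?_
          have h1 := (mem_filter.1 ho).2
          by_cases hoS : o ∈ S
          · have : marginal f S o = 0 := by simp [marginal, insert_eq_of_mem hoS]
            rw [this]
            exact mul_nonneg hρ (totalCost_nonneg hc o)
          · exact le_of_not_ge fun h' => h1 ⟨hoS, h'⟩
      _ = ρ * ∑ o ∈ N, totalCost c o := by rw [mul_sum]
      _ ≤ ρ * (d - H.card * (1 / 2)) := by
          refine mul_le_mul_of_nonneg_left ?_ hρ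
          have := sum_le_sum_of_subset_of_nonneg hNO
            (f := totalCost c) fun o _ _ => totalCost_nonneg hc o
          linarith
  have hd : (0 : ℝ) ≤ d - H.card * (1 / 2) := by
    have : (0 : ℝ) ≤ H.card := Nat.cast_nonneg _
    linarith
  -- With `h = H.card`, `N` and `H` contribute at most `(1 + ε) * v * (3 / 2 * (d - h / 2) + h)`,
  -- that is `(1 + ε) * v * (3 / 2 * d + h / 4)`, and `h ≤ d` gives `7 / 4 * d`.
  have h1 := mul_le_mul_of_nonneg_right hρv hd
  have h2 : (H.card : ℝ) * v ≤ H.card * ((1 + ε) * v) :=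
    mul_le_mul_of_nonneg_left (le_mul_of_one_le_left hv0 (by linarith)) (Nat.cast_nonneg _)
  have h3 : (H.card : ℝ) * ((1 + ε) * v) ≤ d * ((1 + ε) * v) :=
    mul_le_mul_of_nonneg_right hHd (by positivity)
  linarith

/-! ### Bisection for the density -/

open Classical in
/-- The better of the two sets `S` and `T`. -/
noncomputable def better {E : Type} (f : Finset E → ℝ) (S T : Finset E) : Finset E :=
  if f S < f T then T else S

theorem le_better_left {E : Type} (f : Finset E → ℝ) (S T : Finset E) :
    f S ≤ f (better f S T) := by
  unfold better
  split_ifs with h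
  · exact h.le
  · exact le_rfl

theorem le_better_right {E : Type} (f : Finset E → ℝ) (S T : Finset E) :
    f T ≤ f (better f S T) := by
  unfold better
  split_ifs with h
  · exact le_rfl
  · exact not_lt.1 h

theorem better_induction {E : Type} {f : Finset E → ℝ} {P : Finset E → Prop} {S T : Finset E}
    (hS : P S) (hT : P T) : P (better f S T) := by
  unfold better
  split_ifs
  exacts [hT, hS]

open Classical in
/-- The best set among `S` and the feasible singletons. -/
noncomputable def bestSingleton {E : Type} [DecidableEq E] {d : ℕ} (f : Finset E → ℝ)
    (I : Finset (Finset E)) (c : Fin d → E → ℝ) : List E → Finset E → Finset E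
  | [], S => S
  | e :: l, S =>
    if Fits c {e} ∧ decide ({e} ∈ I) = true then bestSingleton f I c l (better f S {e})
    else bestSingleton f I c l S

theorem bestSingleton_spec {E : Type} [DecidableEq E] {d : ℕ} {f : Finset E → ℝ}
    {I : Finset (Finset E)} {c : Fin d → E → ℝ} (l : List E) (S : Finset E)
    (hS : IsFeasible I c S) :
    IsFeasible I c (bestSingleton f I c l S) ∧ f S ≤ f (bestSingleton f I c l S) ∧
      ∀ e ∈ l, IsFeasible I c {e} → f {e} ≤ f (bestSingleton f I c l S) := by
  induction l generalizing S with
  | nil => exact ⟨hS, le_rfl, by simp⟩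
  | cons e l ih =>
    unfold bestSingleton
    split_ifs with h
    · obtain ⟨a1, a2, a3⟩ := ih (better f S {e})
        (better_induction hS ⟨of_decide_eq_true h.2, h.1⟩)
      refine ⟨a1, (le_better_left _ _ _).trans a2, fun x hx hxf => ?_⟩
      rcases List.mem_cons.1 hx with rfl | hx
      · exact (le_better_right _ _ _).trans a2
      · exact a3 x hx hxf
    · obtain ⟨a1, a2, a3⟩ := ih S hS
      refine ⟨a1, a2, fun x hx hxf => ?_⟩
      rcases List.mem_cons.1 hx with rfl | hx
      · exact absurd ⟨hxf.2, decide_eq_true hxf.1⟩ h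
      · exact a3 x hx hxf

/-- The grid of densities. -/
noncomputable def density (ε M : ℝ) (k : ℕ) : ℝ := 3 / 2 * M * (1 + ε) ^ k

/-- Bisection for a density at which a knapsack overflows, but not at the next one, keeping track of
the best set `V` that has been found. -/
noncomputable def bisect {E : Type} [DecidableEq E] {d : ℕ} (f : Finset E → ℝ)
    (I : Finset (Finset E)) (c : Fin d → E → ℝ) (ε M : ℝ) (l : List E) (L : ℕ) :
    ℕ → ℕ → Finset E → Finset E
  | 0, _, V => V
  | r + 1, k, V =>
    bisect f I c ε M l L r
      (if (sweep f I c (density ε M (k + 2 ^ r)) ε l L M ∅).1 = true then k + 2 ^ r else k)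
      (better f V (sweep f I c (density ε M (k + 2 ^ r)) ε l L M ∅).2)

theorem sweep_feasible {E : Type} [DecidableEq E] {d : ℕ} {f : Finset E → ℝ}
    {I : Finset (Finset E)} {c : Fin d → E → ℝ} {p ρ ε : ℝ} (hc : ∀ i e, 0 ≤ c i e)
    (hf : Monotone f) (hs : SubmodularFn f) (h0 : ∀ S, 0 ≤ f S) (hI : IsPSystem p I) (hρ : 0 ≤ ρ)
    (l : List E) (r : ℕ) (τ : ℝ) :
    IsFeasible I c (sweep f I c ρ ε l r τ ∅).2 ∧
      ((sweep f I c ρ ε l r τ ∅).1 = true → 2 / 3 * ρ ≤ f (sweep f I c ρ ε l r τ ∅).2) := by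
  have hempty : IsDense f I c ρ ∅ :=
    ⟨hI.empty_mem, fun i => by simp, by simp, fun T hT => by
      rw [subset_empty.1 hT]; simpa using h0 ∅⟩
  cases h : (sweep f I c ρ ε l r τ ∅).1
  · have := (sweep_completed hf hs hI l r τ ∅ hempty h).2
    exact ⟨⟨this.mem, this.fits⟩, by simp⟩
  · have := sweep_overflow hc hf hs hI hρ l r τ ∅ hempty h
    exact ⟨this.1, fun _ => this.2⟩

/-- The invariant `hhigh` quantifies over all `v ≥ f V` so that it survives improvements of `V`.
When the endpoints are adjacent, `hlow` supplies its density condition with `v = f V`. -/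
theorem bisect_spec {E : Type} [DecidableEq E] {d : ℕ} {f : Finset E → ℝ}
    {I : Finset (Finset E)} {c : Fin d → E → ℝ} {p ε M : ℝ} (hc : ∀ i e, 0 ≤ c i e)
    (hf : Monotone f) (hs : SubmodularFn f) (h0 : ∀ S, 0 ≤ f S) (hI : IsPSystem p I) (hp : 0 ≤ p)
    (hε : 0 < ε) (l : List E) (hl : ∀ e, e ∈ l) (L : ℕ)
    (hL : (l.length : ℝ) ≤ ε * (1 + ε) ^ L)
    (hM : 0 ≤ M) (hsingle : ∀ e, IsFeasible I c {e} → f {e} ≤ M)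
    (r k : ℕ) (V : Finset E) (hV : IsFeasible I c V) (hMV : M ≤ f V)
    (hlow : density ε M k ≤ 3 / 2 * f V)
    (hhigh : ∀ v, f V ≤ v → density ε M (k + 2 ^ r) ≤ 3 / 2 * (1 + ε) * v →
      ∀ O, IsFeasible I c O → f O ≤ (1 + ε) * (p + 7 / 4 * d + 1) * v) :
    IsFeasible I c (bisect f I c ε M l (L + 1) r k V) ∧
      ∀ O, IsFeasible I c O →
        f O ≤ (1 + ε) * (p + 7 / 4 * d + 1) * f (bisect f I c ε M l (L + 1) r k V) := by
  induction r generalizing k V with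
  | zero =>
    refine ⟨hV, hhigh _ le_rfl ?_⟩
    have h1 : density ε M (k + 2 ^ 0) = (1 + ε) * density ε M k := by
      unfold density; rw [pow_zero, pow_succ]; ring
    have := mul_le_mul_of_nonneg_left hlow (by linarith : 0 ≤ 1 + ε)
    rw [h1]
    simp only [bisect]
    linarith
  | succ r ih =>
    unfold bisect
    have hρ : 0 ≤ density ε M (k + 2 ^ r) := by unfold density; positivity
    have hsw := sweep_feasible (ε := ε) hc hf hs h0 hI hρ l (L + 1) M
    have hcomp := fun v a1 a2 a3 a4 O (a5 : IsFeasible I c O) =>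
      le_of_sweep_completed (v := v) hc hf hs h0 hI hp hε hρ l hl L hL hM hsingle a1 a2 a3 a4 a5
    set s := sweep f I c (density ε M (k + 2 ^ r)) ε l (L + 1) M ∅
    have hl := le_better_left f V s.2
    have hr := le_better_right f V s.2
    refine ih _ _ (better_induction hV hsw.1) (hMV.trans hl) ?_ ?_
    · split_ifs with h
      · linarith [hsw.2 h]
      · linarith
    · intro v hv
      split_ifs with h
      · rw [add_assoc, ← two_mul, ← pow_succ']
        exact hhigh v (hl.trans hv)
      · exact fun h' O hO => hcomp v (by simpa using h) (hMV.trans (hl.trans hv)) (hr.trans hv) h'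
          O hO

/-- Best feasible singleton, followed by the bisection for the density. -/
noncomputable def solve {E : Type} [DecidableEq E] {d : ℕ} (f : Finset E → ℝ)
    (I : Finset (Finset E)) (c : Fin d → E → ℝ) (ε : ℝ) (l : List E) (L R : ℕ) : Finset E :=
  let B := bestSingleton f I c l ∅
  let s := sweep f I c (density ε (f B) 0) ε l L (f B) ∅
  if s.1 = true then bisect f I c ε (f B) l L R 0 (better f B s.2) else better f B s.2

theorem solve_spec {E : Type} [DecidableEq E] {d : ℕ} {f : Finset E → ℝ}
    {I : Finset (Finset E)} {c : Fin d → E → ℝ} {p ε : ℝ} (hc : ∀ i e, 0 ≤ c i e)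
    (hf : Monotone f) (hs : SubmodularFn f) (h0 : ∀ S, 0 ≤ f S) (hI : IsPSystem p I) (hp : 0 ≤ p)
    (hε : 0 < ε) (l : List E) (hl : ∀ e, e ∈ l) (L R : ℕ)
    (hL : (l.length : ℝ) ≤ ε * (1 + ε) ^ L) (hR : (l.length : ℝ) ≤ (1 + ε) ^ 2 ^ R) :
    IsFeasible I c (solve f I c ε l (L + 1) R) ∧
      ∀ O, IsFeasible I c O →
        f O ≤ (1 + ε) * (p + 7 / 4 * d + 1) * f (solve f I c ε l (L + 1) R) := by
  obtain ⟨b1, b2, b3⟩ := bestSingleton_spec (f := f) l ∅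
    (⟨hI.empty_mem, fun i => by simp⟩ : IsFeasible I c ∅)
  unfold solve
  simp only
  set B := bestSingleton f I c l ∅
  have hM := h0 B
  have hsingle : ∀ e, IsFeasible I c {e} → f {e} ≤ f B := fun e => b3 e (hl e)
  have hρ : 0 ≤ density ε (f B) 0 := by unfold density; positivity
  have hsw := sweep_feasible (ε := ε) hc hf hs h0 hI hρ l (L + 1) (f B)
  have hcomp := fun v a1 a2 a3 a4 O (a5 : IsFeasible I c O) =>
    le_of_sweep_completed (v := v) hc hf hs h0 hI hp hε hρ l hl L hL hM hsingle a1 a2 a3 a4 a5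
  set s := sweep f I c (density ε (f B) 0) ε l (L + 1) (f B) ∅
  have hleft := le_better_left f B s.2
  have hright := le_better_right f B s.2
  have hρB : density ε (f B) 0 = 3 / 2 * f B := by simp [density]
  split_ifs with h
  · refine bisect_spec hc hf hs h0 hI hp hε l hl L hL hM hsingle R 0 _
      (better_induction b1 hsw.1) hleft (by rw [hρB]; linarith) ?_
    -- The top of the grid needs no sweep: subadditivity gives `f O ≤ n * M` with `n = l.length`,
    -- and `hR` with `hd` turns this into `f O ≤ (1 + ε) * v`. The empty `O` is separate because
    -- absorbing `f ∅` needs `1 ≤ O.card`.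
    intro v hv hd O hO
    have hv0 : 0 ≤ v := (h0 _).trans hv
    have h1 : f O ≤ l.length * f B ∨ f O ≤ f B := by
      by_cases hOe : O = ∅
      · exact Or.inr (hOe ▸ b2)
      · left
        have h2 := union_le_add_sum_marginal hf hs ∅ O
        obtain ⟨x, hx⟩ := nonempty_iff_ne_empty.2 hOe
        have h3 : ∀ o ∈ O, marginal f ∅ o ≤ f B - f ∅ := fun o ho => by
          have := hsingle o ⟨hI.down_closed O hO.1 _ (singleton_subset_iff.2 ho),
            Fits.mono hc hO.2 (singleton_subset_iff.2 ho)⟩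
          simp only [marginal, insert_empty_eq]
          linarith
        have h4 := sum_le_sum h3
        rw [sum_const, nsmul_eq_mul] at h4
        have h5 : (1 : ℝ) ≤ O.card := by exact_mod_cast card_pos.2 ⟨x, hx⟩
        have h6 : (O.card : ℝ) ≤ l.length := by
          have : O ⊆ l.toFinset := fun x _ => List.mem_toFinset.2 (hl x)
          exact_mod_cast (card_le_card this).trans (List.toFinset_card_le l)
        have h7 := mul_le_mul_of_nonneg_right h6 hM
        have h8 := mul_le_mul_of_nonneg_right h5 (h0 ∅)
        rw [empty_union] at h2
        linarith
    have h2 : f O ≤ (1 + ε) * v := by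
      rcases h1 with h1 | h1
      · have := mul_le_mul_of_nonneg_right hR hM
        rw [zero_add] at hd
        unfold density at hd
        linarith
      · linarith [mul_nonneg hε.le hv0]
    have h3 : (0 : ℝ) ≤ (p + 7 / 4 * d) * ((1 + ε) * v) := by positivity
    linarith
  · exact ⟨better_induction b1 hsw.1, hcomp _ (by simpa using h) hleft hright
      (by rw [hρB]; nlinarith [h0 (better f B s.2)])⟩

/-! ### Realization in the oracle model -/

open Classical in
/-- The oracle procedure for `scan`; the procedure `k` continues with its outcome. -/
noncomputable def scanAlg {E : Type} [DecidableEq E] {d : ℕ} (c : Fin d → E → ℝ) (ρ τ : ℝ)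
    (k : Bool × Finset E → OracleAlg E) : List E → Finset E → OracleAlg E
  | [], S => k (false, S)
  | e :: l, S =>
    .askValue (insert e S) fun a => .askValue S fun b => .askIndep (insert e S) fun t =>
      if Light c e ∧ τ ≤ a - b ∧ ρ * totalCost c e ≤ a - b ∧ t = true then
        if Fits c (insert e S) then scanAlg c ρ τ k l (insert e S)
        else k (true, trim c (insert e S))
      else scanAlg c ρ τ k l S

/-- Continuation-passing makes query counts add up under composition; each element costs three
queries. -/
theorem scanAlg_spec {E : Type} [DecidableEq E] {d : ℕ} (f : Finset E → ℝ)
    (I : Finset (Finset E)) (c : Fin d → E → ℝ) (ρ τ : ℝ) (k : Bool × Finset E → OracleAlg E)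
    (l : List E) (S : Finset E) :
    (scanAlg c ρ τ k l S).result f I = (k (scan f I c ρ τ l S)).result f I ∧
      (scanAlg c ρ τ k l S).queries f I ≤
        3 * l.length + (k (scan f I c ρ τ l S)).queries f I := by
  induction l generalizing S with
  | nil => simp [scanAlg, scan]
  | cons e l ih =>
    unfold scanAlg scan
    simp only [OracleAlg.result, OracleAlg.queries, List.length_cons]
    split_ifs
    · exact ⟨(ih _).1, by linarith [(ih (insert e S)).2]⟩
    · exact ⟨rfl, by omega⟩
    · exact ⟨(ih _).1, by linarith [(ih S).2]⟩

/-- The oracle procedure for `sweep`; the procedure `k` continues with its outcome. -/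
noncomputable def sweepAlg {E : Type} [DecidableEq E] {d : ℕ} (c : Fin d → E → ℝ) (ρ ε : ℝ)
    (l : List E) (k : Bool × Finset E → OracleAlg E) : ℕ → ℝ → Finset E → OracleAlg E
  | 0, _, S => k (false, S)
  | r + 1, τ, S =>
    scanAlg c ρ τ (fun s => if s.1 = true then k s else sweepAlg c ρ ε l k r (τ / (1 + ε)) s.2) l S

theorem sweepAlg_spec {E : Type} [DecidableEq E] {d : ℕ} (f : Finset E → ℝ)
    (I : Finset (Finset E)) (c : Fin d → E → ℝ) (ρ ε : ℝ) (l : List E)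
    (k : Bool × Finset E → OracleAlg E) (r : ℕ) (τ : ℝ) (S : Finset E) :
    (sweepAlg c ρ ε l k r τ S).result f I = (k (sweep f I c ρ ε l r τ S)).result f I ∧
      (sweepAlg c ρ ε l k r τ S).queries f I ≤
        3 * l.length * r + (k (sweep f I c ρ ε l r τ S)).queries f I := by
  induction r generalizing τ S with
  | zero => simp [sweepAlg, sweep]
  | succ r ih =>
    unfold sweepAlg sweep
    obtain ⟨a1, a2⟩ := scanAlg_spec f I c ρ τ
      (fun s => if s.1 = true then k s else sweepAlg c ρ ε l k r (τ / (1 + ε)) s.2) l S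
    rw [a1]
    split_ifs at a2 ⊢ with h
    · exact ⟨rfl, a2.trans (by nlinarith [Nat.zero_le (3 * l.length * r)])⟩
    · obtain ⟨b1, b2⟩ := ih (τ / (1 + ε)) (scan f I c ρ τ l S).2
      exact ⟨b1, a2.trans (by nlinarith)⟩

open Classical in
/-- The oracle procedure for `better`; the procedure `k` continues with its outcome. -/
noncomputable def betterAlg {E : Type} (S T : Finset E) (k : Finset E → OracleAlg E) :
    OracleAlg E :=
  .askValue S fun a => .askValue T fun b => if a < b then k T else k S

theorem betterAlg_spec {E : Type} [DecidableEq E] (f : Finset E → ℝ) (I : Finset (Finset E))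
    (S T : Finset E) (k : Finset E → OracleAlg E) :
    (betterAlg S T k).result f I = (k (better f S T)).result f I ∧
      (betterAlg S T k).queries f I = (k (better f S T)).queries f I + 2 := by
  unfold betterAlg better
  simp only [OracleAlg.result, OracleAlg.queries]
  split_ifs <;> simp

open Classical in
/-- The oracle procedure for `bestSingleton`; the procedure `k` continues with its outcome. -/
noncomputable def bestSingletonAlg {E : Type} {d : ℕ} (c : Fin d → E → ℝ)
    (k : Finset E → OracleAlg E) : List E → Finset E → OracleAlg E
  | [], S => k S
  | e :: l, S =>
    .askIndep {e} fun t =>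
      if Fits c {e} ∧ t = true then betterAlg S {e} fun V => bestSingletonAlg c k l V
      else bestSingletonAlg c k l S

theorem bestSingletonAlg_spec {E : Type} [DecidableEq E] {d : ℕ} (f : Finset E → ℝ)
    (I : Finset (Finset E)) (c : Fin d → E → ℝ) (k : Finset E → OracleAlg E)
    (l : List E) (S : Finset E) :
    (bestSingletonAlg c k l S).result f I = (k (bestSingleton f I c l S)).result f I ∧
      (bestSingletonAlg c k l S).queries f I ≤
        3 * l.length + (k (bestSingleton f I c l S)).queries f I := by
  induction l generalizing S with
  | nil => simp [bestSingletonAlg, bestSingleton]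
  | cons e l ih =>
    unfold bestSingletonAlg bestSingleton
    simp only [OracleAlg.result, OracleAlg.queries, List.length_cons]
    split_ifs
    · rw [(betterAlg_spec f I _ _ _).1, (betterAlg_spec f I _ _ _).2]
      exact ⟨(ih _).1, by linarith [(ih (better f S {e})).2]⟩
    · exact ⟨(ih _).1, by linarith [(ih S).2]⟩

/-- The oracle procedure for `bisect`. -/
noncomputable def bisectAlg {E : Type} [DecidableEq E] {d : ℕ} (c : Fin d → E → ℝ) (ε M : ℝ)
    (l : List E) (L : ℕ) : ℕ → ℕ → Finset E → OracleAlg E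
  | 0, _, V => .output V
  | r + 1, k, V =>
    sweepAlg c (density ε M (k + 2 ^ r)) ε l
      (fun s => betterAlg V s.2 fun W =>
        bisectAlg c ε M l L r (if s.1 = true then k + 2 ^ r else k) W) L M ∅

theorem bisectAlg_spec {E : Type} [DecidableEq E] {d : ℕ} (f : Finset E → ℝ)
    (I : Finset (Finset E)) (c : Fin d → E → ℝ) (ε M : ℝ) (l : List E) (L r k : ℕ)
    (V : Finset E) :
    (bisectAlg c ε M l L r k V).result f I = bisect f I c ε M l L r k V ∧
      (bisectAlg c ε M l L r k V).queries f I ≤ r * (3 * l.length * L + 2) := by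
  induction r generalizing k V with
  | zero => simp [bisectAlg, bisect, OracleAlg.result, OracleAlg.queries]
  | succ r ih =>
    unfold bisectAlg bisect
    obtain ⟨a1, a2⟩ := sweepAlg_spec f I c (density ε M (k + 2 ^ r)) ε l
      (fun s => betterAlg V s.2 fun W =>
        bisectAlg c ε M l L r (if s.1 = true then k + 2 ^ r else k) W) L M ∅
    rw [a1]
    simp only [betterAlg_spec] at a2 ⊢
    refine ⟨(ih _ _).1, a2.trans ?_⟩
    have := (ih (if (sweep f I c (density ε M (k + 2 ^ r)) ε l L M ∅).1 = true
      then k + 2 ^ r else k)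
      (better f V (sweep f I c (density ε M (k + 2 ^ r)) ε l L M ∅).2)).2
    linarith

/-- The oracle procedure for `solve`. -/
noncomputable def solveAlg {E : Type} [DecidableEq E] {d : ℕ} (c : Fin d → E → ℝ) (ε : ℝ)
    (l : List E) (L R : ℕ) : OracleAlg E :=
  bestSingletonAlg c (fun B => .askValue B fun M =>
    sweepAlg c (density ε M 0) ε l (fun s => betterAlg B s.2 fun W =>
      if s.1 = true then bisectAlg c ε M l L R 0 W else .output W) L M ∅) l ∅

theorem solveAlg_spec {E : Type} [DecidableEq E] {d : ℕ} (f : Finset E → ℝ)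
    (I : Finset (Finset E)) (c : Fin d → E → ℝ) (ε : ℝ) (l : List E) (L R : ℕ) :
    (solveAlg c ε l L R).result f I = solve f I c ε l L R ∧
      (solveAlg c ε l L R).queries f I ≤
        3 * l.length + 1 + (R + 1) * (3 * l.length * L + 2) := by
  unfold solveAlg solve
  obtain ⟨a1, a2⟩ := bestSingletonAlg_spec f I c (fun B => .askValue B fun M =>
    sweepAlg c (density ε M 0) ε l (fun s => betterAlg B s.2 fun W =>
      if s.1 = true then bisectAlg c ε M l L R 0 W else .output W) L M ∅) l ∅
  rw [a1]
  simp only [OracleAlg.result, OracleAlg.queries] at a2 ⊢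
  set B := bestSingleton f I c l ∅
  obtain ⟨b1, b2⟩ := sweepAlg_spec f I c (density ε (f B) 0) ε l (fun s => betterAlg B s.2 fun W =>
      if s.1 = true then bisectAlg c ε (f B) l L R 0 W else .output W) L (f B) ∅
  rw [b1]
  simp only [betterAlg_spec] at b2 ⊢
  split_ifs at b2 ⊢ with h
  · obtain ⟨c1, c2⟩ := bisectAlg_spec f I c ε (f B) l L R 0
      (better f B (sweep f I c (density ε (f B) 0) ε l L (f B) ∅).2)
    exact ⟨c1, by linarith⟩
  · refine ⟨rfl, ?_⟩
    simp only [OracleAlg.queries] at b2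
    nlinarith [Nat.zero_le (R * (3 * l.length * L + 2))]

/-! ### The choice of the parameters -/

theorem exp_half_le_one_add {ε : ℝ} (h0 : 0 ≤ ε) (h1 : ε ≤ 1) : Real.exp (ε / 2) ≤ 1 + ε := by
  have h2 : 1 - ε / 2 ≤ Real.exp (-(ε / 2)) := by linarith [Real.add_one_le_exp (-(ε / 2))]
  rw [Real.exp_neg] at h2
  have h3 : (1 - ε / 2) * Real.exp (ε / 2) ≤ 1 := by
    calc (1 - ε / 2) * Real.exp (ε / 2) ≤ (Real.exp (ε / 2))⁻¹ * Real.exp (ε / 2) :=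
          mul_le_mul_of_nonneg_right h2 (Real.exp_pos _).le
      _ = 1 := inv_mul_cancel₀ (Real.exp_pos _).ne'
  -- The product is `1 + ε * (1 - ε) / 2`.
  have h4 : (1 : ℝ) ≤ (1 - ε / 2) * (1 + ε) := by nlinarith
  exact le_of_mul_le_mul_left (h3.trans h4) (by linarith)

theorem le_one_add_pow {ε x : ℝ} (h0 : 0 < ε) (h1 : ε ≤ 1) (hx : 0 < x) {m : ℕ}
    (hm : 2 * Real.log x / ε ≤ m) : x ≤ (1 + ε) ^ m := by
  calc x = Real.exp (Real.log x) := (Real.exp_log hx).symm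
    _ ≤ Real.exp (m * (ε / 2)) := by
        rw [Real.exp_le_exp]
        rw [div_le_iff₀ h0] at hm
        linarith
    _ = Real.exp (ε / 2) ^ m := Real.exp_nat_mul _ _
    _ ≤ (1 + ε) ^ m := pow_le_pow_left₀ (Real.exp_pos _).le (exp_half_le_one_add h0.le h1) m

theorem two_mul_log_div_le_two_pow {ε : ℝ} (h0 : 0 < ε) (h1 : ε < 1 / 2) {n R : ℕ} (hn : 1 ≤ n)
    (hR : 6 * max (Real.log (1 / ε)) (Real.log (Real.log n)) ≤ R) :
    2 * Real.log n / ε ≤ ((2 ^ R : ℕ) : ℝ) := by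
  set m := max (Real.log (1 / ε)) (Real.log (Real.log n))
  have hε : 1 / ε ≤ Real.exp m := by
    rw [← Real.log_le_iff_le_exp (by positivity)]
    exact le_max_left _ _
  have h2 : 2 ≤ 1 / ε := by
    rw [le_div_iff₀ h0]; linarith
  have hlog : Real.log n ≤ Real.exp m := by
    have h3 : 0 ≤ Real.log n := Real.log_nonneg (by exact_mod_cast hn)
    -- For `n = 1` the double logarithm is `Real.log 0 = 0`, below `Real.log (1 / ε)`, so the
    -- maximum has its intended value.
    rcases h3.eq_or_lt with h3 | h3
    · rw [← h3]; exact (Real.exp_pos _).le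
    · rw [← Real.log_le_iff_le_exp h3]
      exact le_max_right _ _
  have hm0 : 0 ≤ m := (Real.log_nonneg (by linarith)).trans (le_max_left _ _)
  -- Each of the factors `2`, `Real.log n`, `1 / ε` is at most `exp m`; the constant `6` works
  -- because `6 * log 2 > 3`.
  calc 2 * Real.log n / ε = 2 * Real.log n * (1 / ε) := by ring
    _ ≤ Real.exp m * Real.exp m * Real.exp m := by
        have := Real.log_nonneg (x := n) (by exact_mod_cast hn)
        gcongr
        exact h2.trans hε
    _ = Real.exp (3 * m) := by rw [← Real.exp_add, ← Real.exp_add]; ring_nf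
    _ ≤ Real.exp (R * Real.log 2) := by
        rw [Real.exp_le_exp]
        have := Real.log_two_gt_d9
        have hR0 : (0 : ℝ) ≤ R := Nat.cast_nonneg _
        nlinarith
    _ = ((2 ^ R : ℕ) : ℝ) := by
        rw [Real.exp_nat_mul, Real.exp_log (by norm_num)]
        push_cast
        rfl

/-- The number of thresholds of a sweep, minus one. -/
noncomputable def numThresholds (n : ℕ) (ε : ℝ) : ℕ := ⌈2 * Real.log (n / ε) / ε⌉₊

/-- The number of bisection steps. -/
noncomputable def numBisections (n : ℕ) (ε : ℝ) : ℕ :=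
  ⌈6 * max (Real.log (1 / ε)) (Real.log (Real.log n))⌉₊

theorem query_bound {n : ℕ} {ε : ℝ} (hn : 1 ≤ n) (h0 : 0 < ε) (h1 : ε < 1 / 2) :
    ((3 * n + 1 + (numBisections n ε + 1) * (3 * n * (numThresholds n ε + 1) + 2) : ℕ) : ℝ) ≤
      240 * ((n : ℝ) / ε * Real.log ((n : ℝ) / ε) *
        max (Real.log (1 / ε)) (Real.log (Real.log (n : ℝ)))) := by
  have hn' : (1 : ℝ) ≤ n := by exact_mod_cast hn
  have hlog2 := Real.log_two_gt_d9
  have h2 : 2 ≤ 1 / ε := by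
    rw [le_div_iff₀ h0]; linarith
  have hm : 1 / 2 ≤ max (Real.log (1 / ε)) (Real.log (Real.log (n : ℝ))) := by
    refine le_max_of_le_left ?_
    have := Real.log_le_log (by norm_num) h2
    linarith
  set m := max (Real.log (1 / ε)) (Real.log (Real.log (n : ℝ)))
  have hR : (numBisections n ε : ℝ) < 6 * m + 1 := Nat.ceil_lt_add_one (by positivity)
  have hX : 1 ≤ Real.log (n / ε) / ε := by
    rw [le_div_iff₀ h0]
    have h3 : (2 : ℝ) ≤ n / ε := h2.trans (by gcongr)
    have := Real.log_le_log (by norm_num) h3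
    linarith
  set X := Real.log (n / ε) / ε with hXdef
  have hT : (numThresholds n ε : ℝ) < 2 * X + 1 := by
    have h4 : 2 * Real.log (n / ε) / ε = 2 * X := by rw [hXdef]; ring
    unfold numThresholds
    rw [h4]
    exact Nat.ceil_lt_add_one (by positivity)
  have hgoal : (n : ℝ) / ε * Real.log (n / ε) * m = n * X * m := by rw [hXdef]; ring
  rw [hgoal]
  push_cast
  have hT1 : (numThresholds n ε : ℝ) + 1 ≤ 4 * X := by linarith
  have hnX : (1 : ℝ) ≤ n * X := by nlinarith
  have hrun : 3 * (n : ℝ) * (numThresholds n ε + 1) + 2 ≤ 20 * (n * X) := by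
    have := mul_le_mul_of_nonneg_left hT1 (by positivity : (0 : ℝ) ≤ 3 * n)
    linarith
  have hfirst : 3 * (n : ℝ) + 1 ≤ 20 * (n * X) := by nlinarith
  -- The second `+ 1` counts the singleton phase as one more sweep; `20 * 12` is the constant `240`.
  have hR1 : (numBisections n ε : ℝ) + 1 + 1 ≤ 12 * m := by linarith
  have hprod := mul_le_mul_of_nonneg_left hrun
    (by positivity : (0 : ℝ) ≤ numBisections n ε + 1)
  have hprod2 := mul_le_mul_of_nonneg_right hR1 (by linarith : (0 : ℝ) ≤ 20 * (n * X))
  linarith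

open Classical in
/-- The algorithm: for `ε ≥ 1 / 2` nothing has to be shown about the value, so the empty set
will do. -/
noncomputable def knapsackAlg (n d : ℕ) (c : Fin d → Fin n → ℝ) (ε : ℝ) : OracleAlg (Fin n) :=
  if ε < 1 / 2 then
    solveAlg c ε (List.finRange n) (numThresholds n ε + 1) (numBisections n ε)
  else .output ∅

theorem theorem4 :
    ∃ (K : ℝ)
      (alg : (n d : ℕ) → (c : Fin d → Fin n → ℝ) → (p ε : ℝ) → OracleAlg (Fin n)),
      ∀ (n d : ℕ) (c : Fin d → Fin n → ℝ) (p ε : ℝ) (f : Finset (Fin n) → ℝ)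
        (I : Finset (Finset (Fin n))),
        1 ≤ n → (∀ i e, 0 ≤ c i e) → 1 ≤ p → 0 < ε → ε < 1 →
        (∀ S, 0 ≤ f S) → Monotone f → SubmodularFn f → IsPSystem p I →
        IsFeasible I c ((alg n d c p ε).result f I) ∧
        (∀ T : Finset (Fin n), IsFeasible I c T →
          (1 / (p + 7 / 4 * (d : ℝ) + 1) - ε) * f T ≤ f ((alg n d c p ε).result f I)) ∧
        ((alg n d c p ε).queries f I : ℝ) ≤
          K * ((n : ℝ) / ε * Real.log ((n : ℝ) / ε) *
            max (Real.log (1 / ε)) (Real.log (Real.log (n : ℝ)))) := by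
  refine ⟨240, fun n d c _ ε => knapsackAlg n d c ε, ?_⟩
  intro n d c p ε f I hn hc hp hε hε1 h0 hf hs hI
  have hn' : (1 : ℝ) ≤ n := by exact_mod_cast hn
  have hd : (0 : ℝ) ≤ d := Nat.cast_nonneg d
  simp only [knapsackAlg]
  set q := p + 7 / 4 * (d : ℝ) + 1 with hq
  have hq2 : 2 ≤ q := by linarith
  split_ifs with hhalf
  · obtain ⟨r1, r2⟩ := solveAlg_spec f I c ε (List.finRange n) (numThresholds n ε + 1)
      (numBisections n ε)
    have hL : ((List.finRange n).length : ℝ) ≤ ε * (1 + ε) ^ numThresholds n ε := by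
      have := le_one_add_pow (x := n / ε) hε hε1.le (by positivity)
        (Nat.le_ceil (2 * Real.log (n / ε) / ε))
      rw [div_le_iff₀ hε] at this
      rw [List.length_finRange, mul_comm]
      exact this
    have hR : ((List.finRange n).length : ℝ) ≤ (1 + ε) ^ 2 ^ numBisections n ε := by
      rw [List.length_finRange]
      exact le_one_add_pow hε hε1.le (by positivity)
        (two_mul_log_div_le_two_pow hε hhalf hn (Nat.le_ceil _))
    obtain ⟨s1, s2⟩ := solve_spec hc hf hs h0 hI (by linarith) hε (List.finRange n)
      List.mem_finRange _ _ hL hR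
    rw [r1]
    refine ⟨s1, fun T hT => ?_, ?_⟩
    · have h1 := s2 T hT
      rw [← hq] at h1
      set W := solve f I c ε (List.finRange n) (numThresholds n ε + 1) (numBisections n ε)
      have hW := h0 W
      have hT0 := h0 T
      -- The additive loss `ε` dominates `ε / q`, and `(1 - ε) * (1 + ε) ≤ 1` absorbs the factor `1
      -- + ε` of `solve_spec`.
      have h2 : 1 / q - ε ≤ (1 - ε) / q := by
        rw [sub_div, sub_le_sub_iff_left]
        exact div_le_self hε.le (by linarith)
      calc (1 / q - ε) * f T ≤ (1 - ε) / q * f T := mul_le_mul_of_nonneg_right h2 hT0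
        _ ≤ (1 - ε) / q * ((1 + ε) * q * f W) :=
            mul_le_mul_of_nonneg_left h1 (div_nonneg (by linarith) (by linarith))
        _ = (1 - ε ^ 2) * f W := by field_simp; ring
        _ ≤ f W := by nlinarith [mul_nonneg (sq_nonneg ε) hW]
    · refine le_trans ?_ (query_bound hn hε hhalf)
      rw [List.length_finRange] at r2
      exact_mod_cast r2
  · simp only [OracleAlg.result, OracleAlg.queries, Nat.cast_zero]
    refine ⟨⟨hI.empty_mem, fun i => by simp⟩, fun T _ => ?_, ?_⟩
    · have h1 : 1 / q ≤ 1 / 2 := one_div_le_one_div_of_le (by norm_num) hq2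
      exact (mul_nonpos_of_nonpos_of_nonneg (by linarith) (h0 T)).trans (h0 ∅)
    · have h1 : 0 ≤ Real.log (n / ε) := Real.log_nonneg (by
        rw [le_div_iff₀ hε]; linarith)
      have h2 : 0 ≤ Real.log (1 / ε) := Real.log_nonneg (by
        rw [le_div_iff₀ hε]; linarith)
      have h3 := h2.trans (le_max_left _ (Real.log (Real.log (n : ℝ))))
      positivity
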